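/- For a finite group $K$ and $n \ge 0$, let $\alpha_{K,n}$ be the number of orbits of $K$ on $K^n$ under simultaneous conjugation $g\cdot(x_1,\dots,x_n) = (gx_1g^{-1},\dots,gx_ng^{-1})$, and let $A_K(t)=\sum_{n=0}^\infty \alpha_{K,n}t^n \in \mathbb{Q}[[t]]$. **Theorem.** Let $G$ be a finite Frobenius group with Frobenius kernel $N$ and Frobenius complement $H$; that is, $H$ is a proper non-trivial subgroup of $G$ with $H\cap gHg^{-1}=\{1\}$ for all $g\in G\setminus H$, and $N$ is the subgroup of $G$ whose underlying set is $$N=\Big(G\setminus\bigcup_{g\in G} gHg^{-1}\Big)\cup\{1\}.$$ Then, in $\mathbb{Q}[[t]]$, $$|G|\,A_G(t)=\frac{1}{1-|G|t}+\Big(|N|\,A_N(t)-\frac{1}{1-|N|t}\Big)+|N|\Big(|H|\,A_H(t)-\frac{1}{1-|H|t}\Big).$$ -/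

import Mathlib

open scoped PowerSeries Pointwise

/-- The number `α_{G,n}` of simultaneous conjugacy classes of `n`-tuples in `G`: the number of orbits
of `G` acting on `G^n` by `g • (x₁, …, xₙ) = (g x₁ g⁻¹, …, g xₙ g⁻¹)`. -/
noncomputable def simConjClassNumber (G : Type*) [Group G] (n : ℕ) : ℕ :=
  Nat.card (MulAction.orbitRel.Quotient (ConjAct G) (Fin n → G))

/-- The generating function `A_G(t) = ∑ α_{G,n} tⁿ`, as a formal power series over `ℚ`. -/
noncomputable def simConjSeries (G : Type*) [Group G] : ℚ⟦X⟧ :=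
  PowerSeries.mk fun n => (simConjClassNumber G n : ℚ)

/-- `H` is a Frobenius complement of `G`: a proper non-trivial subgroup with `H ∩ gHg⁻¹ = {1}` for
all `g ∈ G \ H`. -/
structure IsFrobeniusComplement {G : Type*} [Group G] (H : Subgroup G) : Prop where
  ne_bot : H ≠ ⊥
  ne_top : H ≠ ⊤
  inf_conj : ∀ g : G, g ∉ H → H ⊓ (MulAut.conj g • H) = ⊥

/-- The Frobenius kernel of `G` with respect to `H`, as a set:
`(G \ ⋃_{g ∈ G} gHg⁻¹) ∪ {1}`. -/
def frobeniusKernel {G : Type*} [Group G] (H : Subgroup G) : Set G :=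
  (⋃ g : G, ((MulAut.conj g • H : Subgroup G) : Set G))ᶜ ∪ {1}

/-- The geometric series `1 / (1 - c t)` in `ℚ⟦t⟧` (the constant coefficient of the denominator
is `1`, so it is invertible). -/
noncomputable def geomSeries (c : ℕ) : ℚ⟦X⟧ :=
  (1 - PowerSeries.C (c : ℚ) * PowerSeries.X)⁻¹

/-! By Burnside's lemma, the coefficient of `t^n` in `|K| A_K(t)` is the sum of `|C_K(g)|^n` over `g
∈ K`; subtracting the geometric series removes the term of `g = 1`. In `G`, a nontrivial element of
`N` or of `H` has its whole centralizer in that subgroup (`mem_kernel_of_commute`,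
`mem_of_commute`), so its term is the same there as in `G`. Outside `N` lie the nontrivial elements
of the `[G : H] = |N|` conjugates of `H`, each contributing equally. Since `N` is given as a
subgroup, no character theory is needed. -/

theorem coeff_geomSeries (c n : ℕ) : PowerSeries.coeff n (geomSeries c) = (c : ℚ) ^ n := by
  have h : geomSeries c = PowerSeries.mk fun n => (c : ℚ) ^ n := by
    unfold geomSeries
    rw [PowerSeries.inv_eq_iff_mul_eq_one (by simp)]
    ext n
    cases n with
    | zero => simp [mul_sub, ← mul_assoc]
    | succ n =>
      have hc : (PowerSeries.mk fun n => (c : ℚ) ^ n) *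
          (1 - PowerSeries.C (c : ℚ) * PowerSeries.X) =
          (PowerSeries.mk fun n => (c : ℚ) ^ n) -
            PowerSeries.C (c : ℚ) * (PowerSeries.mk fun n => (c : ℚ) ^ n) * PowerSeries.X := by
        ring
      rw [hc, map_sub, PowerSeries.coeff_succ_mul_X, PowerSeries.coeff_C_mul]
      simp [PowerSeries.coeff_one, pow_succ']
  rw [h, PowerSeries.coeff_mk]

/-- The number of elements commuting with `g`. -/
noncomputable def centralizerCard {G : Type*} [Group G] (g : G) : ℕ :=
  Nat.card {x : G // Commute g x}

theorem centralizerCard_one {G : Type*} [Group G] : centralizerCard (1 : G) = Nat.card G :=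
  Nat.card_congr (Equiv.subtypeUnivEquiv fun x => Commute.one_left x)

theorem centralizerCard_conj {G : Type*} [Group G] (y g : G) :
    centralizerCard (y * g * y⁻¹) = centralizerCard g := by
  refine (Nat.card_congr ((MulAut.conj y).toEquiv.subtypeEquiv fun x => ?_)).symm
  change Commute g x ↔ Commute (y * g * y⁻¹) (y * x * y⁻¹)
  simp [commute_iff_eq]

/-- An element whose centralizer lies in `K` has as many commuting elements in `K` as in `G`. -/
theorem centralizerCard_coe_of_forall_mem {G : Type*} [Group G] {K : Subgroup G} (k : K)
    (hk : ∀ x : G, Commute (k : G) x → x ∈ K) :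
    centralizerCard (k : G) = centralizerCard k := by
  refine Nat.card_congr
    { toFun := fun x => ⟨⟨x.1, hk x.1 x.2⟩, Subtype.ext x.2⟩
      invFun := fun x => ⟨x.1.1, congrArg Subtype.val x.2⟩
      left_inv := fun _ => rfl
      right_inv := fun _ => rfl }

/-- Burnside's lemma for simultaneous conjugation of `n`-tuples. -/
theorem card_mul_simConjClassNumber (G : Type*) [Group G] [Fintype G] (n : ℕ) :
    Nat.card G * simConjClassNumber G n = ∑ g : G, centralizerCard g ^ n := by
  classical
  have key := MulAction.sum_card_fixedBy_eq_card_orbits_mul_card_group (ConjAct G) (Fin n → G)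
  have hG : Fintype.card (ConjAct G) = Nat.card G := by
    rw [← Nat.card_eq_fintype_card]
    exact Nat.card_congr ConjAct.ofConjAct.toEquiv
  rw [hG, ← Nat.card_eq_fintype_card, mul_comm] at key
  unfold simConjClassNumber
  rw [← key]
  refine Fintype.sum_equiv ConjAct.ofConjAct.toEquiv _ _ fun g => ?_
  rw [← Nat.card_eq_fintype_card]
  have e : MulAction.fixedBy (Fin n → G) g ≃
      (Fin n → {x : G // Commute (ConjAct.ofConjAct g) x}) :=
    (Equiv.subtypeEquivRight fun f => by
      simp only [MulAction.mem_fixedBy, funext_iff, Pi.smul_apply, ConjAct.smul_def,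
        mul_inv_eq_iff_eq_mul, commute_iff_eq]).trans
      Equiv.subtypePiEquivPi
  rw [Nat.card_congr e, Nat.card_fun, Nat.card_fin]
  rfl

theorem sum_ne_one_add {K : Type*} [Group K] [Fintype K] [Fintype {k : K // k ≠ 1}]
    (F : K → ℕ) : ∑ k : {k : K // k ≠ 1}, F k + F 1 = ∑ k, F k := by
  classical
  rw [← Fintype.sum_subtype_add_sum_subtype (fun k : K => k = 1) F, add_comm]
  congr 1
  · simp only [Finset.univ_unique, Finset.sum_singleton]
    rfl
  · congr!

namespace IsFrobeniusComplement

variable {G : Type*} [Group G] {N H : Subgroup G}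

theorem mem_of_conj_mem (hH : IsFrobeniusComplement H) {y h : G} (hh : h ∈ H) (h1 : h ≠ 1)
    (hy : y * h * y⁻¹ ∈ H) : y ∈ H := by
  by_contra hn
  have hm : y * h * y⁻¹ ∈ H ⊓ MulAut.conj y • H :=
    ⟨hy, Subgroup.smul_mem_pointwise_smul _ _ _ hh⟩
  rw [hH.inf_conj y hn, Subgroup.mem_bot] at hm
  exact h1 (by simpa using hm)

theorem mem_of_commute (hH : IsFrobeniusComplement H) {h x : G} (hh : h ∈ H) (h1 : h ≠ 1)
    (hx : Commute h x) : x ∈ H :=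
  hH.mem_of_conj_mem hh h1 (by rwa [← hx.eq, mul_inv_cancel_right])

theorem mem_kernel_iff (hN : (N : Set G) = frobeniusKernel H) {g : G} :
    g ∈ N ↔ g = 1 ∨ ∀ y : G, y⁻¹ * g * y ∉ H := by
  rw [← SetLike.mem_coe, hN, frobeniusKernel]
  simp [Set.mem_smul_set_iff_inv_smul_mem, ← map_inv]

/-- Otherwise `x` is a nontrivial element of some conjugate of `H`; that conjugate contains the
centralizer of `x`, hence `g`, which is impossible for `1 ≠ g ∈ N`. -/
theorem mem_kernel_of_commute (hH : IsFrobeniusComplement H)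
    (hN : (N : Set G) = frobeniusKernel H) {g x : G} (hg : g ∈ N) (g1 : g ≠ 1)
    (hx : Commute g x) : x ∈ N := by
  by_contra hn
  rw [mem_kernel_iff hN] at hn hg
  push Not at hn
  obtain ⟨x1, y, hy⟩ := hn
  refine (hg.resolve_left g1) y (hH.mem_of_commute hy ?_ ?_)
  · simpa [mul_assoc, inv_mul_eq_one, eq_comm] using x1
  · simpa using hx.symm.map (MulAut.conj y⁻¹)

/-- The complement of the Frobenius kernel is the disjoint union of the nontrivial elements of the
conjugates of `H`, which are indexed by `G ⧸ H`. -/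
theorem exists_equiv_compl_kernel (hH : IsFrobeniusComplement H)
    (hN : (N : Set G) = frobeniusKernel H) :
    ∃ e : (G ⧸ H) × {h : H // h ≠ 1} ≃ {g : G // g ∉ N},
      ∀ p, (e p : G) = p.1.out * p.2.1 * p.1.out⁻¹ := by
  let f : (G ⧸ H) × {h : H // h ≠ 1} → {g : G // g ∉ N} := fun p =>
    ⟨p.1.out * p.2.1 * p.1.out⁻¹, fun hm => by
      rcases (mem_kernel_iff hN).1 hm with h | h
      · exact p.2.2 (by simpa using h)
      · exact h p.1.out (by simp [mul_assoc])⟩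
  refine ⟨Equiv.ofBijective f ⟨?_, ?_⟩, fun _ => rfl⟩
  · rintro ⟨q, h, h1⟩ ⟨r, k, k1⟩ he
    have he' : q.out * (h : G) * q.out⁻¹ = r.out * k * r.out⁻¹ := congrArg Subtype.val he
    have hm : q.out⁻¹ * r.out ∈ H := by
      refine hH.mem_of_conj_mem k.2 (by simpa using k1) ?_
      have : q.out⁻¹ * r.out * k * (q.out⁻¹ * r.out)⁻¹ = h := by
        calc _ = q.out⁻¹ * (r.out * k * r.out⁻¹) * q.out := by group
          _ = h := by rw [← he']; group
      rw [this]
      exact h.2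
    have hqr : q = r := by
      rw [← q.out_eq', ← r.out_eq']
      exact QuotientGroup.eq.2 hm
    subst hqr
    have hk : h = k := by simpa using he'
    subst hk
    rfl
  · rintro ⟨g, hg⟩
    rw [mem_kernel_iff hN] at hg
    push Not at hg
    obtain ⟨g1, y, hy⟩ := hg
    -- The chosen representative of `yH` is `y * h`, so the element of `H` found with `y` must be
    -- conjugated by `h⁻¹`.
    obtain ⟨h, hh⟩ := QuotientGroup.mk_out_eq_mul H y
    let k : H := h⁻¹ * ⟨_, hy⟩ * h
    have hk : ((y : G ⧸ H).out) * (k : G) * ((y : G ⧸ H).out)⁻¹ = g := by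
      rw [hh]
      simp only [k, Subgroup.coe_mul, Subgroup.coe_inv]
      group
    refine ⟨⟨y, k, fun h1 => g1 ?_⟩, Subtype.ext hk⟩
    rw [← hk, h1]
    simp

/-- The sum of a class function over the complement of the Frobenius kernel. -/
theorem sum_not_mem_kernel [Fintype G] [Fintype {g : G // g ∉ N}] [Fintype {h : H // h ≠ 1}]
    (hH : IsFrobeniusComplement H)
    (hN : (N : Set G) = frobeniusKernel H) (F : G → ℕ) (hF : ∀ y g, F (y * g * y⁻¹) = F g) :
    ∑ g : {g : G // g ∉ N}, F g = H.index * ∑ h : {h : H // h ≠ 1}, F h.1 := by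
  classical
  obtain ⟨e, he⟩ := hH.exists_equiv_compl_kernel hN
  rw [← Equiv.sum_comp e, Fintype.sum_prod_type]
  simp only [he, hF]
  rw [Finset.sum_const, smul_eq_mul, Finset.card_univ, ← Nat.card_eq_fintype_card]
  rfl

/-- Counting `G \ N` gives `|G| - |N| = [G : H] (|H| - 1)`. -/
theorem card_kernel_eq_index [Finite G] (hH : IsFrobeniusComplement H)
    (hN : (N : Set G) = frobeniusKernel H) : Nat.card N = H.index := by
  classical
  have := Fintype.ofFinite G
  have h1 := Fintype.sum_subtype_add_sum_subtype (fun g : G => g ∈ N) (fun _ => 1)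
  rw [hH.sum_not_mem_kernel hN (fun _ => 1) fun _ _ => rfl] at h1
  have h2 := sum_ne_one_add (K := H) fun _ => 1
  have h3 := H.index_mul_card
  have hc : ∑ _ : {g : G // g ∈ N}, 1 = Nat.card N := by simp
  have hcH : ∑ _ : H, 1 = Nat.card H := by simp
  have hcG : ∑ _ : G, 1 = Nat.card G := by simp
  rw [hc, hcG] at h1
  rw [hcH] at h2
  rw [← h2, ← h1] at h3
  linarith

/-- The coefficientwise identity, with negative terms moved across to avoid truncated subtraction in
`ℕ`. -/
theorem card_mul_simConjClassNumber_add [Finite G] (hH : IsFrobeniusComplement H)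
    (hN : (N : Set G) = frobeniusKernel H) (n : ℕ) :
    Nat.card G * simConjClassNumber G n + Nat.card N ^ n + Nat.card N * Nat.card H ^ n =
      Nat.card G ^ n + Nat.card N * simConjClassNumber N n +
        Nat.card N * (Nat.card H * simConjClassNumber H n) := by
  classical
  have := Fintype.ofFinite G
  simp only [card_mul_simConjClassNumber]
  rw [← Fintype.sum_subtype_add_sum_subtype (fun g : G => g ∈ N) (fun g => centralizerCard g ^ n),
    hH.sum_not_mem_kernel hN (fun g => centralizerCard g ^ n)
      fun y g => by rw [centralizerCard_conj],
    ← hH.card_kernel_eq_index hN]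
  have eN := sum_ne_one_add fun k : N => centralizerCard (k : G) ^ n
  have eN' := sum_ne_one_add fun k : N => centralizerCard k ^ n
  have eH := sum_ne_one_add fun k : H => centralizerCard k ^ n
  have hNs : ∑ k : {k : N // k ≠ 1}, centralizerCard (k.1 : G) ^ n =
      ∑ k : {k : N // k ≠ 1}, centralizerCard k.1 ^ n :=
    Fintype.sum_congr _ _ fun k => by
      rw [centralizerCard_coe_of_forall_mem k.1 fun x hx =>
        hH.mem_kernel_of_commute hN k.1.2 (by simpa using k.2) hx]
  have hHs : ∑ k : {k : H // k ≠ 1}, centralizerCard (k.1 : G) ^ n =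
      ∑ k : {k : H // k ≠ 1}, centralizerCard k.1 ^ n :=
    Fintype.sum_congr _ _ fun k => by
      rw [centralizerCard_coe_of_forall_mem k.1 fun x hx =>
        hH.mem_of_commute k.1.2 (by simpa using k.2) hx]
  -- Only the identity's term depends on the ambient group: `|G|^n` in `eN`, but `|N|^n` in `eN'`.
  simp only [OneMemClass.coe_one, centralizerCard_one] at eN eN' eH
  rw [hHs, ← eH, ← eN', ← eN, hNs]
  ring

end IsFrobeniusComplement

theorem theorem9p2 {G : Type*} [Group G] [Finite G] (N H : Subgroup G)
    (hH : IsFrobeniusComplement H) (hN : (N : Set G) = frobeniusKernel H) :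
    (Nat.card G : ℚ⟦X⟧) * simConjSeries G =
      geomSeries (Nat.card G)
        + ((Nat.card N : ℚ⟦X⟧) * simConjSeries N - geomSeries (Nat.card N))
        + (Nat.card N : ℚ⟦X⟧) *
            ((Nat.card H : ℚ⟦X⟧) * simConjSeries H - geomSeries (Nat.card H)) := by
  ext n
  have hcast : ∀ c : ℕ, (c : ℚ⟦X⟧) = PowerSeries.C (c : ℚ) := fun c => (map_natCast _ c).symm
  have key := congrArg (Nat.cast : ℕ → ℚ) (hH.card_mul_simConjClassNumber_add hN n)
  push_cast at key
  simp only [hcast, map_add, map_sub, PowerSeries.coeff_C_mul, coeff_geomSeries, simConjSeries,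
    PowerSeries.coeff_mk]
  linarith
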